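/- Let $Q$ be a smooth (finite-dimensional, Hausdorff, boundaryless) manifold with tangent bundle $\tau_Q : TQ \to Q$, and let $\Gamma$ be a second-order differential equation (SODE) on $Q$, i.e. a smooth vector field on $TQ$ with $T\tau_Q(\Gamma(v)) = v$ for all $v \in TQ$. Denote by $\phi_t^\Gamma$ the (local) flow of $\Gamma$. Let $q_0 \in Q$, and for $h > 0$ put $$M_{h,q_0}^\Gamma = \{v \in T_{q_0}Q \mid \phi_t^\Gamma(v) \text{ is defined for all } t \in [0,h]\}, \qquad \exp_{h,q_0}^\Gamma(v) = \tau_Q(\phi_h^\Gamma(v)) \quad (v \in M_{h,q_0}^\Gamma).$$ Fix a norm on $T_{q_0}Q$. There are $h_0 > 0$ and $C \in \mathbb{R}$ such that for every $h$ with $0 < h < h_0$ the set $M_{h,q_0}^\Gamma$ is open in $T_{q_0}Q$ and there are an open set $V \subseteq M_{h,q_0}^\Gamma$ and an open set $U \subseteq Q$ with $q_0 \in U$ such that: 1. $\exp_{h,q_0}^\Gamma$ restricts to a diffeomorphism from $V$ onto $U$; 2. the tangent map $T_v \exp_{h,q_0}^\Gamma : T_{q_0}Q \to T_{\exp_{h,q_0}^\Gamma(v)}Q$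 is bijective for every $v \in V$ (here $T_v(T_{q_0}Q)$ is identified with $T_{q_0}Q$ by vertical lift); 3. the (unique) $v_h \in V$ with $\exp_{h,q_0}^\Gamma(v_h) = q_0$ satisfies $\|T_{v_h}\exp_{h,q_0}^\Gamma(w) - h\,w\| \le C h^2 \|w\|$ for all $w \in T_{q_0}Q$. -/

import Mathlib

open Set Manifold
open scoped Manifold ContDiff Topology

noncomputable section

section Flow

variable {F : Type*} [NormedAddCommGroup F] [NormedSpace ℝ F]
  {H : Type*} [TopologicalSpace H] {I : ModelWithCorners ℝ F H}
  {M : Type*} [TopologicalSpace M] [ChartedSpace H M]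

/-- `FlowDefinedAt X t p`: the flow of the vector field `X` starting at `p` is defined at time `t`,
that is, some integral curve of `X` with value `p` at time `0` is defined on an open interval `J`
containing `0` and `t`. -/
def FlowDefinedAt (X : (x : M) → TangentSpace I x) (t : ℝ) (p : M) : Prop :=
  ∃ (γ : ℝ → M) (J : Set ℝ), IsOpen J ∧ J.OrdConnected ∧ (0 : ℝ) ∈ J ∧ t ∈ J ∧
    γ 0 = p ∧ IsMIntegralCurveOn γ X J

open Classical in
/-- The flow `φ_t^X(p)` of the vector field `X`: the value at time `t` of an integral curve of `X`
starting at `p`. The value is junk where the flow is not defined. On a Hausdorff manifold without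
boundary and for a `C^1` vector field the value does not depend on the choice of the curve. -/
def vectorFieldFlow (X : (x : M) → TangentSpace I x) (t : ℝ) (p : M) : M :=
  if hp : FlowDefinedAt X t p then hp.choose t else p

end Flow

section SODE

variable {E : Type*} [NormedAddCommGroup E] [NormedSpace ℝ E]
  {Q : Type*} [TopologicalSpace Q] [ChartedSpace E Q] [IsManifold 𝓘(ℝ, E) ∞ Q]

/-- A smooth vector field `Γ` on `TQ` is a second-order differential equation (SODE) if
`T τ_Q (Γ v) = v` for all `v` in `TQ`, where `τ_Q : TQ → Q` is the projection. (Equivalently, the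
vertical endomorphism sends `Γ` to the Liouville vector field.) -/
structure IsSODE (Γ : (p : TangentBundle 𝓘(ℝ, E) Q) → TangentSpace 𝓘(ℝ, E).tangent p) :
    Prop where
  smooth : ContMDiff 𝓘(ℝ, E).tangent 𝓘(ℝ, E).tangent.tangent ∞
    (fun p => (⟨p, Γ p⟩ : TangentBundle 𝓘(ℝ, E).tangent (TangentBundle 𝓘(ℝ, E) Q)))
  second_order : ∀ p : TangentBundle 𝓘(ℝ, E) Q,
    mfderiv 𝓘(ℝ, E).tangent 𝓘(ℝ, E)
      (Bundle.TotalSpace.proj : TangentBundle 𝓘(ℝ, E) Q → Q) p (Γ p) = p.2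

/-- The set `M_{h,q₀}^Γ` of the `v ∈ T_{q₀}Q` such that `φ_t^Γ(v)` is defined for `t ∈ [0,h]`.
The tangent space `T_{q₀}Q` is by definition (a copy of) the model space `E`; we write `E` so that
its norm and its smooth structure as a vector space are available. -/
def expDomain (Γ : (p : TangentBundle 𝓘(ℝ, E) Q) → TangentSpace 𝓘(ℝ, E).tangent p)
    (h : ℝ) (q₀ : Q) : Set E :=
  {v | ∀ t ∈ Icc (0 : ℝ) h, FlowDefinedAt Γ t (⟨q₀, v⟩ : TangentBundle 𝓘(ℝ, E) Q)}

/-- The exponential map `exp_{h,q₀}^Γ(v) = τ_Q(φ_h^Γ(v))` for `v ∈ T_{q₀}Q`. -/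
def expMap (Γ : (p : TangentBundle 𝓘(ℝ, E) Q) → TangentSpace 𝓘(ℝ, E).tangent p)
    (h : ℝ) (q₀ : Q) (v : E) : Q :=
  (vectorFieldFlow Γ h (⟨q₀, v⟩ : TangentBundle 𝓘(ℝ, E) Q)).proj

/-- The tangent map `T_v exp_{h,q₀}^Γ`, from `T_v(T_{q₀}Q) = T_{q₀}Q` (vertical lifts at `v` of
vectors at `q₀`) to the tangent space of `Q` at `exp_{h,q₀}^Γ(v)`. Where
`exp_{h,q₀}^Γ(v) = q₀`, both spaces are `T_{q₀}Q`, represented by `E` in the same way. -/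
def tangentExpMap (Γ : (p : TangentBundle 𝓘(ℝ, E) Q) → TangentSpace 𝓘(ℝ, E).tangent p)
    (h : ℝ) (q₀ : Q) (v : E) : E →L[ℝ] E :=
  mfderiv 𝓘(ℝ, E) 𝓘(ℝ, E) (expMap Γ h q₀) v

/-- `f` restricts to a (smooth) diffeomorphism from the open set `V` onto the open set `U`. -/
def IsDiffeoOn (f : E → Q) (V : Set E) (U : Set Q) : Prop :=
  IsOpen V ∧ IsOpen U ∧ BijOn f V U ∧ ContMDiffOn 𝓘(ℝ, E) 𝓘(ℝ, E) ∞ f V ∧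
    ∃ g : Q → E, LeftInvOn g f V ∧ ContMDiffOn 𝓘(ℝ, E) 𝓘(ℝ, E) ∞ g U

end SODE

end

/-!
In a chart at `q₀` the base integral curves of `Γ` solve a second-order equation `x'' = f (x, x')`.
Substituting `x t = x₀ + h • y (t / h)` turns the problem at time `h` into a problem at time `1`
that depends smoothly on `h` and becomes `y'' = 0` at `h = 0`. In terms of the rescaled acceleration
`a` it reads `a = h • f (x₀ + h • y, w)` with `w = v + ∫ a` and `y = ∫ w`, an equation in the Banach
space `C([-1, 2], E)` (an interval larger than `[0, 1]`, so that the curve lives on an open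
neighbourhood of `[0, h]`). Composition with a smooth map is smooth on such a space
(`ContDiff.continuousMap_comp`), and at `h = 0` the derivative in `a` is the identity, so the inverse
function theorem gives `exists_scaled_solution`: the exponential map reads `x₀ + h • G (h, v)` in
the chart, with `G` smooth near `(0, 0)` and `G (0, v) = v` (`IsSODE.exists_expMap_eq`).

The map `(h, v) ↦ (h, G (h, v))` is then a local diffeomorphism at the origin; its slices at fixed
`h` provide `V` and `U`, and `U` contains `q₀` for small `h` because `(h, 0)` is in the target. Since
`∂G/∂v` is the identity at `h = 0` and is locally Lipschitz in `h`, the tangent map `h • ∂G/∂v`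
differs from `h • id` by `O(h²)`.

Openness of `expDomain` concerns initial velocities of any size, so it does not follow from the
rescaling. It is a general fact about flows on Hausdorff manifolds (`isOpen_setOf_flowDefinedAt`),
obtained by continuing the local flows of the Picard-Lindelöf theorem along an integral curve.
-/

/-! ### Smoothness of composition on spaces of continuous maps -/

section Composition

universe u

variable {K : Type*} [TopologicalSpace K] [CompactSpace K]

/-- Pointwise application of a continuous family of operators to a continuous family of vectors,
as a continuous bilinear map. -/
noncomputable def ContinuousMap.applyCLM (K : Type*) [TopologicalSpace K] [CompactSpace K]
    (A B : Type*) [NormedAddCommGroup A] [NormedSpace ℝ A]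
    [NormedAddCommGroup B] [NormedSpace ℝ B] :
    C(K, A →L[ℝ] B) →L[ℝ] C(K, A) →L[ℝ] C(K, B) :=
  LinearMap.mkContinuous₂
    (LinearMap.mk₂ ℝ (fun (T : C(K, A →L[ℝ] B)) (z : C(K, A)) =>
        (⟨fun k => T k (z k), by fun_prop⟩ : C(K, B)))
      (fun _ _ _ => by ext; simp) (fun _ _ _ => by ext; simp)
      (fun _ _ _ => by ext; simp) (fun _ _ _ => by ext; simp))
    1 (fun T z => by
      rw [one_mul, ContinuousMap.norm_le _ (by positivity)]
      intro k
      refine ((T k).le_opNorm (z k)).trans ?_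
      gcongr
      exacts [T.norm_coe_le_norm k, z.norm_coe_le_norm k])

@[simp]
theorem ContinuousMap.applyCLM_apply {A B : Type*} [NormedAddCommGroup A] [NormedSpace ℝ A]
    [NormedAddCommGroup B] [NormedSpace ℝ B] (T : C(K, A →L[ℝ] B)) (z : C(K, A)) (k : K) :
    ContinuousMap.applyCLM K A B T z k = T k (z k) := rfl

theorem ContDiff.hasFDerivAt_continuousMap_comp {A B : Type*} [NormedAddCommGroup A]
    [NormedSpace ℝ A] [NormedAddCommGroup B] [NormedSpace ℝ B] {f : A → B}
    (hf : ContDiff ℝ 1 f) (z : C(K, A)) :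
    HasFDerivAt (fun z : C(K, A) => (⟨f, hf.continuous⟩ : C(A, B)).comp z)
      (ContinuousMap.applyCLM K A B
        ((⟨fderiv ℝ f, hf.continuous_fderiv one_ne_zero⟩ : C(A, A →L[ℝ] B)).comp z)) z := by
  set D : C(A, A →L[ℝ] B) := ⟨fderiv ℝ f, hf.continuous_fderiv one_ne_zero⟩
  rw [hasFDerivAt_iff_isLittleO, Asymptotics.isLittleO_iff]
  intro ε hε
  obtain ⟨δ, hδ, H⟩ : ∃ δ > 0, ∀ y : C(K, A), Dist.dist y z < δ → Dist.dist (D.comp y) (D.comp z) < ε :=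
    Metric.continuous_iff.1 (ContinuousMap.continuous_postcomp D) z ε hε
  filter_upwards [Metric.ball_mem_nhds z hδ] with z' hz'
  rw [ContinuousMap.norm_le _ (by positivity)]
  intro k
  have hk : ‖z' k - z k‖ ≤ ‖z' - z‖ := (z' - z).norm_coe_le_norm k
  have hz : ‖z' - z‖ < δ := by simpa [dist_eq_norm] using hz'
  -- a constant shift of `z` moves `z k` to an arbitrary point of the ball around it
  have hb : ∀ x ∈ Metric.ball (z k) δ, ‖fderiv ℝ f x - fderiv ℝ f (z k)‖ ≤ ε := by
    intro x hx
    have h1 : Dist.dist (z + ContinuousMap.const K (x - z k)) z < δ := by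
      rw [ContinuousMap.dist_lt_iff hδ]
      intro j
      simpa [dist_eq_norm] using hx
    have h2 := (ContinuousMap.norm_coe_le_norm (_ - _ : C(K, A →L[ℝ] B)) k).trans
      ((dist_eq_norm (E := C(K, A →L[ℝ] B)) _ _).symm.le.trans (H _ h1).le)
    simpa [D] using h2
  have h3 := (convex_ball (z k) δ).norm_image_sub_le_of_norm_fderiv_le'
    (fun x _ => (hf.differentiable one_ne_zero).differentiableAt) hb
    (Metric.mem_ball_self hδ) (y := z' k)
    (by rw [Metric.mem_ball, dist_eq_norm]; exact hk.trans_lt hz)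
  simp only [ContinuousMap.sub_apply, ContinuousMap.comp_apply, ContinuousMap.coe_mk,
    ContinuousMap.applyCLM_apply, D]
  exact h3.trans (by gcongr)

/-- Composition with a fixed smooth map is smooth on `C(K, A)`. The derivative is again a
composition followed by a bilinear map, so one inducts on the order of differentiability. -/
theorem ContDiff.continuousMap_comp {A B : Type u} [NormedAddCommGroup A]
    [NormedSpace ℝ A] [NormedAddCommGroup B] [NormedSpace ℝ B] {f : A → B}
    (hf : ContDiff ℝ ∞ f) :
    ContDiff ℝ ∞ (fun z : C(K, A) => (⟨f, hf.continuous⟩ : C(A, B)).comp z) := by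
  rw [contDiff_infty]
  intro n
  induction n generalizing B with
  | zero => exact contDiff_zero.2 (ContinuousMap.continuous_postcomp _)
  | succ n ih =>
    have hf1 : ContDiff ℝ 1 f := hf.of_le (by exact_mod_cast le_top)
    have hd := fun z : C(K, A) => hf1.hasFDerivAt_continuousMap_comp z
    push_cast
    rw [contDiff_succ_iff_fderiv]
    refine ⟨fun z => (hd z).differentiableAt, by simp, ?_⟩
    rw [funext fun z => (hd z).fderiv]
    exact (ContinuousMap.applyCLM K A B).contDiff.comp
      (ih (hf.fderiv_right (m := ∞) (by simp)))

end Composition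

/-! ### The inverse function theorem with a smooth inverse on an open set -/

/-- Smoothness at a single point only gives `C^n` on neighbourhoods depending on `n`; restricting
to the open set where the derivative is invertible makes the local inverse smooth throughout. -/
theorem ContDiffOn.exists_openPartialHomeomorph {A B : Type*} [NormedAddCommGroup A]
    [NormedSpace ℝ A] [CompleteSpace A] [NormedAddCommGroup B] [NormedSpace ℝ B]
    {f : A → B} {s : Set A} (hs : IsOpen s) (hf : ContDiffOn ℝ ∞ f s) {a : A} (ha : a ∈ s)
    {f' : A ≃L[ℝ] B} (hf' : HasFDerivAt f (f' : A →L[ℝ] B) a) :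
    ∃ e : OpenPartialHomeomorph A B, a ∈ e.source ∧ e.source ⊆ s ∧ (e : A → B) = f ∧
      ContDiffOn ℝ ∞ e.symm e.target := by
  have hfa : ContDiffAt ℝ ∞ f a := hf.contDiffAt (hs.mem_nhds ha)
  set e₁ := hfa.toOpenPartialHomeomorph f hf' (by simp)
  set s' : Set A := s ∩ fderiv ℝ f ⁻¹' range ((↑) : (A ≃L[ℝ] B) → A →L[ℝ] B)
  have hs' : IsOpen s' :=
    (hf.continuousOn_fderiv_of_isOpen hs (by simp)).isOpen_inter_preimage hs
      ContinuousLinearEquiv.isOpen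
  refine ⟨e₁.restrOpen s' hs', ⟨hfa.mem_toOpenPartialHomeomorph_source hf' (by simp), ha, f',
    hf'.fderiv.symm⟩, fun x hx => hx.2.1, rfl, ?_⟩
  intro y hy
  have hx := (e₁.restrOpen s' hs').map_target hy
  obtain ⟨φ, hφ⟩ := hx.2.2
  have hc : ContDiffAt ℝ ∞ f ((e₁.restrOpen s' hs').symm y) := hf.contDiffAt (hs.mem_nhds hx.2.1)
  refine (OpenPartialHomeomorph.contDiffAt_symm _ hy (f₀' := φ) ?_ hc).contDiffWithinAt
  rw [hφ]
  exact (hc.differentiableAt (by simp)).hasFDerivAt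

/-! ### The rescaled second-order equation -/

section Scaled

universe u

variable {E : Type u} [NormedAddCommGroup E] [NormedSpace ℝ E]

/-- The primitive vanishing at `0` of a continuous function on `[-1, 2]`, extended to `ℝ` by
continuing the function by its boundary values. -/
noncomputable def primitive (a : C(Icc (-1 : ℝ) 2, E)) (t : ℝ) : E :=
  ∫ r in (0 : ℝ)..t, a (projIcc (-1) 2 (by norm_num) r)

theorem continuous_comp_projIcc {F : Type*} [TopologicalSpace F] (a : C(Icc (-1 : ℝ) 2, F)) :
    Continuous fun r => a (projIcc (-1) 2 (by norm_num) r) :=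
  a.continuous.comp continuous_projIcc

theorem hasDerivAt_primitive [CompleteSpace E] (a : C(Icc (-1 : ℝ) 2, E)) (t : ℝ) :
    HasDerivAt (primitive a) (a (projIcc (-1) 2 (by norm_num) t)) t :=
  intervalIntegral.integral_hasDerivAt_right ((continuous_comp_projIcc a).intervalIntegrable _ _)
    (continuous_comp_projIcc a).aestronglyMeasurable.stronglyMeasurableAtFilter
    (continuous_comp_projIcc a).continuousAt

@[simp]
theorem primitive_zero_right (a : C(Icc (-1 : ℝ) 2, E)) : primitive a 0 = 0 := by
  simp [primitive]

/-- The primitive as a continuous linear operator on `C([-1, 2], E)`. -/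
noncomputable def primitiveCLM (E : Type*) [NormedAddCommGroup E] [NormedSpace ℝ E]
    [CompleteSpace E] : C(Icc (-1 : ℝ) 2, E) →L[ℝ] C(Icc (-1 : ℝ) 2, E) :=
  LinearMap.mkContinuous
    { toFun := fun a => ⟨fun t => primitive a t, (continuous_iff_continuousAt.2 fun t =>
        (hasDerivAt_primitive a t).continuousAt).comp continuous_subtype_val⟩
      map_add' := fun a b => by
        ext t
        exact intervalIntegral.integral_add ((continuous_comp_projIcc a).intervalIntegrable _ _)
          ((continuous_comp_projIcc b).intervalIntegrable _ _)
      map_smul' := fun c a => by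
        ext t
        exact intervalIntegral.integral_smul c _ }
    2 (fun a => by
      rw [ContinuousMap.norm_le _ (by positivity)]
      rintro ⟨t, h₁, h₂⟩
      have h := intervalIntegral.norm_integral_le_of_norm_le_const (a := (0 : ℝ)) (b := t)
        (f := fun r => a (projIcc (-1) 2 (by norm_num) r)) (C := ‖a‖)
        (fun r _ => a.norm_coe_le_norm _)
      have ht : |t - 0| ≤ 2 := by rw [abs_le]; constructor <;> linarith
      calc _ ≤ ‖a‖ * |t - 0| := h
        _ ≤ 2 * ‖a‖ := by nlinarith [norm_nonneg a])

@[simp]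
theorem primitiveCLM_apply [CompleteSpace E] (a : C(Icc (-1 : ℝ) 2, E)) (t : Icc (-1 : ℝ) 2) :
    primitiveCLM E a t = primitive a t := rfl

/-- The velocity `v + ∫ a` as a linear function of the initial velocity `v` and the (rescaled)
acceleration `a`; the first real parameter, the time scale, is ignored. -/
noncomputable def velocityCLM (E : Type*) [NormedAddCommGroup E] [NormedSpace ℝ E]
    [CompleteSpace E] : (ℝ × E) × C(Icc (-1 : ℝ) 2, E) →L[ℝ] C(Icc (-1 : ℝ) 2, E) :=
  ContinuousLinearMap.const ℝ _ ∘L ContinuousLinearMap.snd ℝ ℝ E ∘L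
      ContinuousLinearMap.fst ℝ (ℝ × E) C(Icc (-1 : ℝ) 2, E) +
    primitiveCLM E ∘L ContinuousLinearMap.snd ℝ (ℝ × E) C(Icc (-1 : ℝ) 2, E)

@[simp]
theorem velocityCLM_apply [CompleteSpace E] (p : (ℝ × E) × C(Icc (-1 : ℝ) 2, E))
    (t : Icc (-1 : ℝ) 2) : velocityCLM E p t = p.1.2 + primitive p.2 t := rfl

/-- The phase-space curve `(x₀ + h • y, w)` with rescaled time, where `w = v + ∫ a` and
`y = ∫ w`, as a function of `((h, v), a)`. -/
noncomputable def phaseCurve [CompleteSpace E] (x₀ : E) (p : (ℝ × E) × C(Icc (-1 : ℝ) 2, E)) :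
    C(Icc (-1 : ℝ) 2, E × E) :=
  (ContinuousLinearMap.inl ℝ E E).compLeftContinuous ℝ _
      (ContinuousLinearMap.const ℝ _ x₀ + p.1.1 • primitiveCLM E (velocityCLM E p)) +
    (ContinuousLinearMap.inr ℝ E E).compLeftContinuous ℝ _ (velocityCLM E p)

theorem phaseCurve_apply [CompleteSpace E] (x₀ : E) (p : (ℝ × E) × C(Icc (-1 : ℝ) 2, E))
    (t : Icc (-1 : ℝ) 2) : phaseCurve x₀ p t =
      (x₀ + p.1.1 • primitive (velocityCLM E p) t, velocityCLM E p t) := by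
  simp [phaseCurve]

theorem contDiff_phaseCurve [CompleteSpace E] (x₀ : E) : ContDiff ℝ ∞ (phaseCurve x₀) := by
  unfold phaseCurve
  fun_prop

/-- For a second-order equation `x'' = f (x, x')`, the solution with `x 0 = x₀`, `x' 0 = v` is, at
time `h`, of the form `x₀ + h • G (h, v)` with `G` smooth up to and including `h = 0`, where
`G (0, v) = v`. Rescaling time by `h`, the acceleration `a` on `[-1, 2]` satisfies
`a = h • f (x₀ + h • y, w)` with `w = v + ∫ a` and `y = ∫ w`; at `h = 0` this is solved by `a = 0`
and the inverse function theorem on `C([-1, 2], E)` applies. -/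
theorem exists_scaled_solution [CompleteSpace E] {f : E × E → E} (hf : ContDiff ℝ ∞ f) (x₀ : E)
    {O : Set (E × E)} (hO : O ∈ 𝓝 (x₀, 0)) :
    ∃ (N : Set (ℝ × E)) (G : ℝ × E → E), IsOpen N ∧ (0, 0) ∈ N ∧ ContDiffOn ℝ ∞ G N ∧
      (∀ v, ((0 : ℝ), v) ∈ N → G (0, v) = v) ∧
      ∀ h v, (h, v) ∈ N → 0 < h → ∃ x w : ℝ → E, x 0 = x₀ ∧ w 0 = v ∧ x h = x₀ + h • G (h, v) ∧
        ∀ t ∈ Ioo (-h) (2 * h), HasDerivAt x (w t) t ∧ HasDerivAt w (f (x t, w t)) t ∧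
          (x t, w t) ∈ O := by
  set fK : C(Icc (-1 : ℝ) 2, E × E) → C(Icc (-1 : ℝ) 2, E) :=
    fun z => (⟨f, hf.continuous⟩ : C(E × E, E)).comp z with hfK
  have hfKc : ContDiff ℝ ∞ fK := hf.continuousMap_comp
  set Θ : (ℝ × E) × C(Icc (-1 : ℝ) 2, E) → (ℝ × E) × C(Icc (-1 : ℝ) 2, E) :=
    fun p => (p.1, p.2 - p.1.1 • fK (phaseCurve x₀ p)) with hΘ
  have hg : ContDiff ℝ ∞ fun p => fK (phaseCurve x₀ p) := hfKc.comp (contDiff_phaseCurve x₀)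
  have hΘc : ContDiff ℝ ∞ Θ := by
    exact contDiff_fst.prodMk (contDiff_snd.sub ((contDiff_fst.comp contDiff_fst).smul hg))
  set c := fK (phaseCurve x₀ 0)
  set S : (ℝ × E) × C(Icc (-1 : ℝ) 2, E) →L[ℝ] C(Icc (-1 : ℝ) 2, E) :=
    (ContinuousLinearMap.fst ℝ ℝ E ∘L
      ContinuousLinearMap.fst ℝ (ℝ × E) C(Icc (-1 : ℝ) 2, E)).smulRight c with hS
  -- the derivative at the origin is a shear: `∂a` of the right-hand side vanishes at `h = 0`
  set Θ' : ((ℝ × E) × C(Icc (-1 : ℝ) 2, E)) ≃L[ℝ] (ℝ × E) × C(Icc (-1 : ℝ) 2, E) :=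
    ContinuousLinearEquiv.equivOfInverse
      ((ContinuousLinearMap.fst ℝ (ℝ × E) C(Icc (-1 : ℝ) 2, E)).prod
        (ContinuousLinearMap.snd ℝ (ℝ × E) C(Icc (-1 : ℝ) 2, E) - S))
      ((ContinuousLinearMap.fst ℝ (ℝ × E) C(Icc (-1 : ℝ) 2, E)).prod
        (ContinuousLinearMap.snd ℝ (ℝ × E) C(Icc (-1 : ℝ) 2, E) + S))
      (fun p => by simp [S]) (fun p => by simp [S]) with hΘ'
  have hΘd : HasFDerivAt Θ (Θ' : (ℝ × E) × C(Icc (-1 : ℝ) 2, E) →L[ℝ] _) 0 := by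
    have h1 : HasFDerivAt (fun p : (ℝ × E) × C(Icc (-1 : ℝ) 2, E) => p.1.1)
        (ContinuousLinearMap.fst ℝ ℝ E ∘L
          ContinuousLinearMap.fst ℝ (ℝ × E) C(Icc (-1 : ℝ) 2, E)) 0 :=
      hasFDerivAt_fst.comp _ hasFDerivAt_fst
    have h2 := h1.smul (hg.differentiable (by simp)).differentiableAt.hasFDerivAt
    have h3 := hasFDerivAt_fst.prodMk (hasFDerivAt_snd.sub h2)
    refine h3.congr_fderiv ?_
    simp [hΘ', c, hS]
    rfl
  obtain ⟨e, he0, -, heΘ, hes⟩ :=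
    hΘc.contDiffOn.exists_openPartialHomeomorph isOpen_univ (mem_univ _) hΘd
  have hΘ0 : Θ 0 = 0 := by simp [hΘ]
  set j : ℝ × E → (ℝ × E) × C(Icc (-1 : ℝ) 2, E) := fun p => (p, 0)
  have hj : ContDiff ℝ ∞ j := by fun_prop
  -- on `N₀`, `e.symm ∘ j` solves the equation
  set N₀ : Set (ℝ × E) := j ⁻¹' e.target ∩ j ⁻¹' e.source
  have hN₀ : IsOpen N₀ :=
    (e.open_target.preimage hj.continuous).inter (e.open_source.preimage hj.continuous)
  have h0N₀ : (0, 0) ∈ N₀ := by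
    refine ⟨?_, he0⟩
    have := e.map_source he0
    rwa [heΘ, hΘ0] at this
  have hsymm : ContDiffOn ℝ ∞ (fun p => e.symm (j p)) N₀ :=
    hes.comp hj.contDiffOn fun p hp => hp.1
  have hsol : ∀ p ∈ N₀, Θ (e.symm (j p)) = j p := fun p hp => by
    rw [← heΘ]; exact e.right_inv hp.1
  have hsol0 : ∀ v, ((0 : ℝ), v) ∈ N₀ → e.symm (j (0, v)) = j (0, v) := fun v hv => by
    have h1 : Θ (j (0, v)) = j (0, v) := by simp [hΘ, j]
    rw [← heΘ] at h1
    conv_lhs => rw [← h1]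
    exact e.left_inv hv.2
  obtain ⟨ε, hε, hεO⟩ := Metric.mem_nhds_iff.1 hO
  have hcurve : ContinuousOn (fun p => phaseCurve x₀ (e.symm (j p))) N₀ :=
    ((contDiff_phaseCurve x₀).comp_contDiffOn hsymm).continuousOn
  refine ⟨N₀ ∩ (fun p => phaseCurve x₀ (e.symm (j p))) ⁻¹'
      Metric.ball (phaseCurve x₀ (e.symm (j (0, 0)))) ε,
    fun p => primitiveCLM E (velocityCLM E (e.symm (j p))) ⟨1, by norm_num, by norm_num⟩,
    hcurve.isOpen_inter_preimage hN₀ Metric.isOpen_ball, ⟨h0N₀, Metric.mem_ball_self hε⟩, ?_, ?_,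
    ?_⟩
  · have h1 := ((ContinuousMap.evalCLM ℝ (⟨1, by norm_num, by norm_num⟩ : Icc (-1 : ℝ) 2) ∘L
      primitiveCLM E ∘L velocityCLM E).contDiff (n := ∞)).comp_contDiffOn hsymm
    exact h1.mono inter_subset_left
  · intro v hv
    change primitiveCLM E (velocityCLM E (e.symm (j (0, v)))) _ = v
    rw [hsol0 v hv.1]
    simp [primitive, j]
  · rintro h v ⟨hN, hball⟩ hh
    set q := e.symm (j (h, v)) with hq
    have hΘq : Θ q = ((h, v), 0) := hsol _ hN
    have hq1 : q.1 = (h, v) := congrArg Prod.fst hΘq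
    have hq2 : q.2 = h • fK (phaseCurve x₀ q) := by
      have := congrArg Prod.snd hΘq
      simp only [hΘ, hq1] at this
      exact sub_eq_zero.1 this
    have hin : ∀ t ∈ Ioo (-h) (2 * h), t / h ∈ Icc (-1 : ℝ) 2 := fun t ht =>
      ⟨by rw [le_div_iff₀ hh]; linarith [ht.1], by rw [div_le_iff₀ hh]; exact ht.2.le⟩
    refine ⟨fun t => x₀ + h • primitive (velocityCLM E q) (t / h),
      fun t => v + primitive q.2 (t / h), by simp, by simp, by simp [hh.ne', q], ?_⟩
    intro t ht
    have hd : HasDerivAt (fun t : ℝ => t / h) (1 / h) t := (hasDerivAt_id t).div_const h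
    have hproj := projIcc_of_mem (a := (-1 : ℝ)) (b := 2) (by norm_num) (hin t ht)
    have hph := phaseCurve_apply x₀ q ⟨t / h, hin t ht⟩
    simp only [hq1, velocityCLM_apply] at hph
    refine ⟨?_, ?_, ?_⟩
    · have h1 := (((hasDerivAt_primitive (velocityCLM E q) (t / h)).scomp t hd).const_smul h
        ).const_add x₀
      rw [hproj, smul_smul, mul_one_div_cancel hh.ne', one_smul, velocityCLM_apply, hq1] at h1
      exact h1
    · have h1 := ((hasDerivAt_primitive q.2 (t / h)).scomp t hd).const_add v
      rw [hproj] at h1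
      refine h1.congr_deriv ?_
      rw [← hph]
      conv_lhs => rw [hq2]
      simp [hfK, smul_smul, inv_mul_cancel₀ hh.ne']
    · rw [← hph]
      apply hεO
      have h1 : phaseCurve x₀ (e.symm (j (0, 0))) ⟨t / h, hin t ht⟩ = (x₀, 0) := by
        rw [hsol0 0 h0N₀, phaseCurve_apply]
        simp [j, primitive]
      rw [← h1]
      exact (ContinuousMap.dist_apply_le_dist _).trans_lt hball

end Scaled

/-! ### The total space of a fibre bundle is Hausdorff -/

theorem FiberBundle.t2Space_totalSpace {B F : Type*} {V : B → Type*} [TopologicalSpace B]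
    [TopologicalSpace F] [TopologicalSpace (Bundle.TotalSpace F V)] [∀ b, TopologicalSpace (V b)]
    [FiberBundle F V] [T2Space B] [T2Space F] : T2Space (Bundle.TotalSpace F V) := by
  refine ⟨fun p q hpq => ?_⟩
  by_cases h : p.proj = q.proj
  · set e := trivializationAt F V p.proj
    have hp : p ∈ e.source := FiberBundle.mem_trivializationAt_proj_source
    have hq : q ∈ e.source := by
      rw [e.mem_source, ← h]
      exact FiberBundle.mem_baseSet_trivializationAt' p.proj
    obtain ⟨u, v, hu, hv, hpu, hqv, huv⟩ := t2_separation fun he => hpq (e.injOn hp hq he)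
    exact ⟨e.source ∩ e ⁻¹' u, e.source ∩ e ⁻¹' v,
      e.continuousOn_toFun.isOpen_inter_preimage e.open_source hu,
      e.continuousOn_toFun.isOpen_inter_preimage e.open_source hv, ⟨hp, hpu⟩, ⟨hq, hqv⟩,
      (huv.preimage e).mono inter_subset_right inter_subset_right⟩
  · exact separated_by_continuous (FiberBundle.continuous_proj F V) h

/-! ### Flows of vector fields on manifolds -/

section Flow

variable {F : Type*} [NormedAddCommGroup F] [NormedSpace ℝ F]
  {H : Type*} [TopologicalSpace H] {I : ModelWithCorners ℝ F H}
  {M : Type*} [TopologicalSpace M] [ChartedSpace H M]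

theorem IsOpen.exists_Ioo_subset_of_ordConnected {J : Set ℝ} (hJ : IsOpen J)
    (hJ' : J.OrdConnected) {s t : ℝ} (hs : s ∈ J) (ht : t ∈ J) :
    ∃ a b, s ∈ Ioo a b ∧ t ∈ Ioo a b ∧ Ioo a b ⊆ J := by
  have hmin : min s t ∈ J := by rcases min_choice s t with h | h <;> rwa [h]
  have hmax : max s t ∈ J := by rcases max_choice s t with h | h <;> rwa [h]
  obtain ⟨a, ha, haJ⟩ := exists_Ioc_subset_of_mem_nhds (hJ.mem_nhds hmin) (exists_lt _)
  obtain ⟨b, hb, hbJ⟩ := exists_Ico_subset_of_mem_nhds (hJ.mem_nhds hmax) (exists_gt _)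
  refine ⟨a, b, ⟨ha.trans_le (min_le_left _ _), (le_max_left _ _).trans_lt hb⟩,
    ⟨ha.trans_le (min_le_right _ _), (le_max_right _ _).trans_lt hb⟩, fun r hr => ?_⟩
  rcases le_total r (min s t) with h | h
  · exact haJ ⟨hr.1, h⟩
  · rcases le_total (max s t) r with h' | h'
    · exact hbJ ⟨h', hr.2⟩
    · exact hJ'.out hmin hmax ⟨h, h'⟩

/-- The local representative of the vector field `X` in the preferred chart at `x₀`. -/
noncomputable def chartField [IsManifold I 1 M] (X : (x : M) → TangentSpace I x) (x₀ : M) (z : F) :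
    F :=
  tangentCoordChange I ((extChartAt I x₀).symm z) x₀ ((extChartAt I x₀).symm z)
    (X ((extChartAt I x₀).symm z))

theorem contDiffOn_chartField [IsManifold I ∞ M] [IsManifold I 1 M]
    {X : (x : M) → TangentSpace I x}
    (hX : ContMDiff I I.tangent ∞ (fun x => (⟨x, X x⟩ : TangentBundle I M))) (x₀ : M) :
    ContDiffOn ℝ ∞ (chartField X x₀) (extChartAt I x₀).target := by
  have h := (contMDiff_iff.1 hX).2 x₀ ⟨x₀, X x₀⟩
  refine (h.snd.mono ?_).congr ?_
  · intro z hz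
    refine ⟨hz, ?_⟩
    have := (extChartAt I x₀).map_target hz
    simp only [mem_preimage, extChartAt_source, TangentBundle.mem_chart_source_iff] at this ⊢
    exact this
  · intro z hz
    rfl

/-- A curve solving the equation of the local representative of `X` is carried by the chart to an
integral curve of `X`. -/
theorem hasMFDerivAt_extChartAt_symm_comp [IsManifold I 1 M] [I.Boundaryless]
    {X : (x : M) → TangentSpace I x} {x₀ : M} {z : ℝ → F} {t : ℝ}
    (hz : HasDerivAt z (chartField X x₀ (z t)) t) (hzt : z t ∈ (extChartAt I x₀).target) :
    HasMFDerivAt 𝓘(ℝ, ℝ) I ((extChartAt I x₀).symm ∘ z) t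
      ((1 : ℝ →L[ℝ] ℝ).smulRight (X ((extChartAt I x₀).symm (z t)))) := by
  set xₜ : M := (extChartAt I x₀).symm (z t) with hxt
  have hft1 : xₜ ∈ (extChartAt I x₀).source := (extChartAt I x₀).map_target hzt
  have hft2 := mem_extChartAt_source (I := I) xₜ
  set w : F := X xₜ
  have hw : tangentCoordChange I x₀ xₜ xₜ (chartField X x₀ (z t)) = w :=
    (tangentCoordChange_comp (v := w) ⟨⟨hft2, hft1⟩, hft2⟩).trans (tangentCoordChange_self hft2)
  suffices h : HasDerivAt ((extChartAt I xₜ ∘ (extChartAt I x₀).symm) ∘ z) w t by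
    have h' : HasFDerivWithinAt ((extChartAt I xₜ ∘ (extChartAt I x₀).symm) ∘ z)
        ((1 : ℝ →L[ℝ] ℝ).smulRight w) univ t :=
      (h.hasFDerivAt.congr_fderiv (by ext; simp)).hasFDerivWithinAt
    refine ⟨(continuousAt_extChartAt_symm'' hzt).comp hz.continuousAt, ?_⟩
    simpa only [mfld_simps] using! h'
  rw [← hw]
  refine HasFDerivAt.comp_hasDerivAt _ ?_ hz
  refine HasFDerivWithinAt.hasFDerivAt (s := range I) ?_ ?_
  · rw [← (extChartAt I x₀).right_inv hzt]
    exact hasFDerivWithinAt_tangentCoordChange ⟨hft1, hft2⟩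
  · exact Filter.mem_of_superset (extChartAt_target_mem_nhds' hzt)
      (extChartAt_target_subset_range x₀)

section Unique

variable [IsManifold I 1 M] [I.Boundaryless] [T2Space M]
  {X : (x : M) → TangentSpace I x}

theorem IsMIntegralCurveOn.eq_of_eq_zero
    (hX : ContMDiff I I.tangent 1 (fun x => (⟨x, X x⟩ : TangentBundle I M)))
    {γ γ' : ℝ → M} {J J' : Set ℝ} (hJ : IsOpen J) (hJc : J.OrdConnected) (hJ' : IsOpen J')
    (hJc' : J'.OrdConnected) (h0 : (0 : ℝ) ∈ J) (h0' : (0 : ℝ) ∈ J') {t : ℝ} (ht : t ∈ J)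
    (ht' : t ∈ J') (hγ : IsMIntegralCurveOn γ X J) (hγ' : IsMIntegralCurveOn γ' X J')
    (h : γ 0 = γ' 0) : γ t = γ' t := by
  obtain ⟨a, b, h0ab, htab, hab⟩ := (hJ.inter hJ').exists_Ioo_subset_of_ordConnected
    (hJc.inter hJc') ⟨h0, h0'⟩ ⟨ht, ht'⟩
  exact isMIntegralCurveOn_Ioo_eqOn_of_contMDiff_boundaryless h0ab hX
    (hγ.mono (hab.trans inter_subset_left)) (hγ'.mono (hab.trans inter_subset_right)) h htab

/-- The flow is computed by any integral curve through the initial point. -/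
theorem vectorFieldFlow_eq
    (hX : ContMDiff I I.tangent 1 (fun x => (⟨x, X x⟩ : TangentBundle I M)))
    {γ : ℝ → M} {J : Set ℝ} (hJ : IsOpen J) (hJc : J.OrdConnected) (h0 : (0 : ℝ) ∈ J) {t : ℝ}
    (ht : t ∈ J) (hγ : IsMIntegralCurveOn γ X J) : vectorFieldFlow X t (γ 0) = γ t := by
  have hp : FlowDefinedAt X t (γ 0) := ⟨γ, J, hJ, hJc, h0, ht, rfl, hγ⟩
  rw [vectorFieldFlow, dif_pos hp]
  obtain ⟨J', hJ', hJc', h0', ht', h, hγ'⟩ := hp.choose_spec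
  exact hγ'.eq_of_eq_zero hX hJ' hJc' hJ hJc h0' h0 ht' ht hγ h

/-- The flow property: the flow for time `r` from the point reached at time `s` continues the
integral curve up to time `s + r`. -/
theorem FlowDefinedAt.add
    (hX : ContMDiff I I.tangent 1 (fun x => (⟨x, X x⟩ : TangentBundle I M))) {s r : ℝ} {p : M}
    (hs : FlowDefinedAt X s p) (hr : FlowDefinedAt X r (vectorFieldFlow X s p)) :
    FlowDefinedAt X (s + r) p ∧
      vectorFieldFlow X (s + r) p = vectorFieldFlow X r (vectorFieldFlow X s p) := by
  obtain ⟨γ, J, hJ, hJc, h0, hsJ, rfl, hγ⟩ := hs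
  have hflow := vectorFieldFlow_eq hX hJ hJc h0 hsJ hγ
  rw [hflow] at hr ⊢
  obtain ⟨σ, J', hJ', hJc', h0', hrJ', hσ0, hσ⟩ := hr
  rw [← hσ0, vectorFieldFlow_eq hX hJ' hJc' h0' hrJ' hσ]
  obtain ⟨a, b, h0ab, hsab, hab⟩ := hJ.exists_Ioo_subset_of_ordConnected hJc h0 hsJ
  obtain ⟨a', b', h0ab', hrab', hab'⟩ := hJ'.exists_Ioo_subset_of_ordConnected hJc' h0' hrJ'
  have hσ' : IsMIntegralCurveOn (σ ∘ (· + -s)) X (Ioo (a' + s) (b' + s)) := by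
    refine ((hσ.mono hab').comp_add (-s)).mono fun t ht => ?_
    simp only [mem_ofPred_eq, mem_Ioo] at ht ⊢
    constructor <;> linarith [ht.1, ht.2]
  have hs' : s ∈ Ioo a b ∩ Ioo (a' + s) (b' + s) :=
    ⟨hsab, by constructor <;> linarith [h0ab'.1, h0ab'.2]⟩
  have hval : γ s = (σ ∘ (· + -s)) s := by simp [hσ0]
  have hpw := isMIntegralCurveOn_piecewise hX (hγ.mono hab) hσ' hs' hval
  have hsr : s + r ∈ Ioo (a' + s) (b' + s) := by constructor <;> linarith [hrab'.1, hrab'.2]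
  have heq := eqOn_piecewise_of_isMIntegralCurveOn_Ioo hX (hγ.mono hab) hσ' hs' hval hsr
  have hconn : (Ioo a b ∪ Ioo (a' + s) (b' + s)).OrdConnected :=
    (IsPreconnected.union s hs'.1 hs'.2 isPreconnected_Ioo isPreconnected_Ioo).ordConnected
  have hopen : IsOpen (Ioo a b ∪ Ioo (a' + s) (b' + s)) := isOpen_Ioo.union isOpen_Ioo
  have hpw0 : (Ioo a b).piecewise γ (σ ∘ (· + -s)) 0 = γ 0 := piecewise_eq_of_mem _ _ _ h0ab
  refine ⟨⟨_, _, hopen, hconn, Or.inl h0ab, Or.inr hsr, hpw0, hpw⟩, ?_⟩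
  have := vectorFieldFlow_eq hX hopen hconn (Or.inl h0ab) (Or.inr hsr) hpw
  rw [hpw0] at this
  rw [this, heq]
  simp

/-- Local existence of the flow for a uniform time, with continuous dependence on the initial
point. -/
theorem exists_local_flow [CompleteSpace F]
    (hX : ContMDiff I I.tangent 1 (fun x => (⟨x, X x⟩ : TangentBundle I M)))
    (hXc : ∀ x₀ : M, ContDiffOn ℝ 1 (chartField X x₀) (extChartAt I x₀).target) (x₀ : M) :
    ∃ ε > 0, ∃ W : Set M, IsOpen W ∧ x₀ ∈ W ∧ ∀ r ∈ Ioo (-ε) ε,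
      (∀ p ∈ W, FlowDefinedAt X r p) ∧ ContinuousOn (vectorFieldFlow X r) W := by
  set c := extChartAt I x₀
  have hct : c.target ∈ 𝓝 (c x₀) := extChartAt_target_mem_nhds x₀
  obtain ⟨ε, hε, a, r, _, _, hr, hpl⟩ :=
    IsPicardLindelof.of_contDiffAt_one ((hXc x₀).contDiffAt hct)
  obtain ⟨α, hα, hαc⟩ :=
    (hpl 0).exists_forall_mem_closedBall_eq_hasDerivWithinAt_continuousOn
  simp only [zero_sub, zero_add] at hα hαc
  have hz0 : c x₀ ∈ Metric.closedBall (c x₀) r := Metric.mem_closedBall_self r.2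
  have h00 : (0 : ℝ) ∈ Icc (-ε) ε := ⟨by linarith, hε.le⟩
  -- shrink the time and the ball so that the solutions stay in the chart
  have hmem : α ⁻¹' c.target ∈ 𝓝 (c x₀, (0 : ℝ)) := by
    have hnhds : Metric.closedBall (c x₀) r ×ˢ Icc (-ε) ε ∈ 𝓝 (c x₀, (0 : ℝ)) :=
      prod_mem_nhds (Metric.closedBall_mem_nhds _ hr) (Icc_mem_nhds (by linarith) hε)
    refine (hαc.continuousAt hnhds).preimage_mem_nhds ?_
    rw [(hα _ hz0).1]
    exact hct
  obtain ⟨B, hB, T, hT, hBT⟩ := mem_nhds_prod_iff.1 hmem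
  obtain ⟨η, hη, hηT⟩ := Metric.mem_nhds_iff.1 hT
  have hBr := Filter.inter_mem hB (Metric.ball_mem_nhds (c x₀) hr)
  set W : Set M := c.source ∩ c ⁻¹' interior (B ∩ Metric.ball (c x₀) r)
  have hW : IsOpen W := (continuousOn_extChartAt x₀).isOpen_inter_preimage
    (isOpen_extChartAt_source x₀) isOpen_interior
  set δ := min ε η
  have hδ : 0 < δ := lt_min hε hη
  have hcurve : ∀ p ∈ W, IsMIntegralCurveOn (c.symm ∘ fun t => α (c p, t)) X (Ioo (-δ) δ) := by
    intro p hp t ht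
    have hpB := interior_subset hp.2
    have htε : t ∈ Ioo (-ε) ε :=
      ⟨by linarith [ht.1, min_le_left ε η], ht.2.trans_le (min_le_left _ _)⟩
    have htη : t ∈ T := hηT (by
      rw [Metric.mem_ball, Real.dist_eq, sub_zero, abs_lt]
      exact ⟨by linarith [ht.1, min_le_right ε η], ht.2.trans_le (min_le_right _ _)⟩)
    exact (hasMFDerivAt_extChartAt_symm_comp
      (((hα _ (Metric.ball_subset_closedBall hpB.2)).2 t (Ioo_subset_Icc_self htε)).hasDerivAt
        (Icc_mem_nhds htε.1 htε.2)) (hBT ⟨hpB.1, htη⟩)).hasMFDerivWithinAt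
  have hinit : ∀ p ∈ W, (c.symm ∘ fun t => α (c p, t)) 0 = p := by
    intro p hp
    have hpB := interior_subset hp.2
    simp only [Function.comp_apply]
    rw [(hα _ (Metric.ball_subset_closedBall hpB.2)).1, c.left_inv hp.1]
  have h0δ : (0 : ℝ) ∈ Ioo (-δ) δ := ⟨by linarith, hδ⟩
  refine ⟨δ, hδ, W, hW, ⟨mem_extChartAt_source x₀, mem_interior_iff_mem_nhds.2 hBr⟩,
    fun s hs => ⟨fun p hp =>
      ⟨_, _, isOpen_Ioo, ordConnected_Ioo, h0δ, hs, hinit p hp, hcurve p hp⟩, ?_⟩⟩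
  have hsε : s ∈ Icc (-ε) ε :=
    ⟨by linarith [hs.1, min_le_left ε η], hs.2.le.trans (min_le_left _ _)⟩
  have hsT : s ∈ T := hηT (by
    rw [Metric.mem_ball, Real.dist_eq, sub_zero, abs_lt]
    exact ⟨by linarith [hs.1, min_le_right ε η], hs.2.trans_le (min_le_right _ _)⟩)
  have hcont : ContinuousOn (fun p => c.symm (α (c p, s))) W := by
    refine (continuousOn_extChartAt_symm x₀).comp (hαc.comp (((continuousOn_extChartAt x₀).mono
      inter_subset_left).prodMk continuousOn_const) fun p hp => ?_) fun p hp => ?_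
    · exact ⟨Metric.ball_subset_closedBall (interior_subset hp.2).2, hsε⟩
    · exact hBT ⟨(interior_subset hp.2).1, hsT⟩
  refine hcont.congr fun p hp => ?_
  have := vectorFieldFlow_eq hX isOpen_Ioo ordConnected_Ioo h0δ hs (hcurve p hp)
  rwa [hinit p hp] at this

/-- The domain of the time-`t` flow is open: the set of times up to which the flow is defined near
`p` and continuous at `p` is relatively open and closed in the interval from `0` to `t`. -/
theorem isOpen_setOf_flowDefinedAt [CompleteSpace F]
    (hX : ContMDiff I I.tangent 1 (fun x => (⟨x, X x⟩ : TangentBundle I M)))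
    (hXc : ∀ x₀ : M, ContDiffOn ℝ 1 (chartField X x₀) (extChartAt I x₀).target) (t : ℝ) :
    IsOpen {p : M | FlowDefinedAt X t p} := by
  rw [isOpen_iff_mem_nhds]
  rintro p ⟨γ, J, hJ, hJc, h0, htJ, rfl, hγ⟩
  set P : ℝ → Prop := fun s =>
    (∀ᶠ p in 𝓝 (γ 0), FlowDefinedAt X s p) ∧ ContinuousAt (vectorFieldFlow X s) (γ 0) with hP
  have hflow : ∀ s ∈ J, vectorFieldFlow X s (γ 0) = γ s := fun s hs =>
    vectorFieldFlow_eq hX hJ hJc h0 hs hγ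
  have hP0 : P 0 := by
    obtain ⟨ε, hε, W, hW, h0W, hloc⟩ := exists_local_flow hX hXc (γ 0)
    obtain ⟨h1, h2⟩ := hloc 0 ⟨by linarith, hε⟩
    exact ⟨Filter.mem_of_superset (hW.mem_nhds h0W) h1, h2.continuousAt (hW.mem_nhds h0W)⟩
  have hstep : ∀ s ∈ J, ∀ᶠ s' in 𝓝[J] s, P s ↔ P s' := by
    intro s hs
    obtain ⟨ε, hε, W, hW, hsW, hloc⟩ := exists_local_flow hX hXc (γ s)
    have key : ∀ s₁ ∈ J, ∀ s₂ ∈ J, γ s₁ ∈ W → s₂ - s₁ ∈ Ioo (-ε) ε → P s₁ → P s₂ := by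
      rintro s₁ hs₁ s₂ hs₂ hW₁ hd ⟨hdef, hcont⟩
      obtain ⟨hlocd, hlocc⟩ := hloc _ hd
      have hWn : W ∈ 𝓝 (vectorFieldFlow X s₁ (γ 0)) := by
        rw [hflow s₁ hs₁]; exact hW.mem_nhds hW₁
      have hev : ∀ᶠ p in 𝓝 (γ 0), FlowDefinedAt X s₂ p ∧
          vectorFieldFlow X s₂ p = vectorFieldFlow X (s₂ - s₁) (vectorFieldFlow X s₁ p) := by
        filter_upwards [hdef, hcont.preimage_mem_nhds hWn] with p hp hpW
        have := hp.add hX (hlocd _ hpW)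
        rwa [add_sub_cancel] at this
      exact ⟨hev.mono fun p hp => hp.1, ((hlocc.continuousAt hWn).comp hcont).congr
        (hev.mono fun p hp => hp.2.symm)⟩
    have hγs : ∀ᶠ s' in 𝓝[J] s, γ s' ∈ W :=
      hγ.continuousWithinAt hs (hW.mem_nhds hsW)
    have hclose : ∀ᶠ s' in 𝓝[J] s, s' ∈ Ioo (s - ε) (s + ε) :=
      mem_nhdsWithin_of_mem_nhds (Ioo_mem_nhds (by linarith) (by linarith))
    filter_upwards [hγs, hclose, self_mem_nhdsWithin] with s' h1 h2 h3
    exact ⟨key s hs s' h3 hsW ⟨by linarith [h2.1], by linarith [h2.2]⟩,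
      key s' h3 s hs h1 ⟨by linarith [h2.2], by linarith [h2.1]⟩⟩
  exact (((isPreconnected_iff_ordConnected.2 hJc).induction₂ (fun s s' => P s ↔ P s') hstep
    (fun _ _ _ _ _ _ h1 h2 => h1.trans h2) (fun _ _ _ _ h => h.symm) h0 htJ).1 hP0).1

end Unique

end Flow

/-! ### Second-order equations in a chart -/

section SODE

variable {E : Type*} [NormedAddCommGroup E] [NormedSpace ℝ E]
  {Q : Type*} [TopologicalSpace Q] [ChartedSpace E Q] [IsManifold 𝓘(ℝ, E) ∞ Q]

theorem mem_extChartAt_tangent_source {q₀ : Q} {v₀ : E} {p : TangentBundle 𝓘(ℝ, E) Q} :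
    p ∈ (extChartAt 𝓘(ℝ, E).tangent (⟨q₀, v₀⟩ : TangentBundle 𝓘(ℝ, E) Q)).source ↔
      p.proj ∈ (extChartAt 𝓘(ℝ, E) q₀).source := by
  simp only [extChartAt_source, TangentBundle.mem_chart_source_iff]

theorem mem_extChartAt_tangent_target {q₀ : Q} {v₀ : E} {z : E × E} :
    z ∈ (extChartAt 𝓘(ℝ, E).tangent (⟨q₀, v₀⟩ : TangentBundle 𝓘(ℝ, E) Q)).target ↔
      z.1 ∈ (extChartAt 𝓘(ℝ, E) q₀).target := by
  rw [FiberBundle.extChartAt_target]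
  simpa using fun h => (chartAt E q₀).map_target h

theorem extChartAt_tangent_apply {q₀ : Q} {v₀ : E} (p : TangentBundle 𝓘(ℝ, E) Q) :
    extChartAt 𝓘(ℝ, E).tangent (⟨q₀, v₀⟩ : TangentBundle 𝓘(ℝ, E) Q) p =
      (extChartAt 𝓘(ℝ, E) q₀ p.proj, tangentCoordChange 𝓘(ℝ, E) p.proj q₀ p.proj p.2) := rfl

theorem extChartAt_tangent_apply_base (q₀ : Q) (v₀ v : E) :
    extChartAt 𝓘(ℝ, E).tangent (⟨q₀, v₀⟩ : TangentBundle 𝓘(ℝ, E) Q)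
      (⟨q₀, v⟩ : TangentBundle 𝓘(ℝ, E) Q) = (extChartAt 𝓘(ℝ, E) q₀ q₀, v) := by
  rw [extChartAt_tangent_apply]
  exact congrArg _ (tangentCoordChange_self (mem_extChartAt_source q₀))

variable {Γ : (p : TangentBundle 𝓘(ℝ, E) Q) → TangentSpace 𝓘(ℝ, E).tangent p}

/-- In the chart at `p`, in which `TangentSpace 𝓘(ℝ, E).tangent p` is `E × E`, the projection
`TQ → Q` is the first projection. -/
theorem IsSODE.fst_eq (hΓ : IsSODE Γ) (p : TangentBundle 𝓘(ℝ, E) Q) :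
    (show E × E from Γ p).1 = (show E from p.2) := by
  have hd : MDifferentiableAt 𝓘(ℝ, E).tangent 𝓘(ℝ, E)
      (Bundle.TotalSpace.proj : TangentBundle 𝓘(ℝ, E) Q → Q) p :=
    (Bundle.contMDiff_proj (n := ∞) (TangentSpace 𝓘(ℝ, E))).mdifferentiableAt (by simp)
  set c := extChartAt 𝓘(ℝ, E).tangent p
  set φ := extChartAt 𝓘(ℝ, E) p.proj
  have h1 : HasFDerivWithinAt (φ ∘ Bundle.TotalSpace.proj ∘ c.symm)
      (show E × E →L[ℝ] E from mfderiv 𝓘(ℝ, E).tangent 𝓘(ℝ, E)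
      (Bundle.TotalSpace.proj : TangentBundle 𝓘(ℝ, E) Q → Q) p) (range 𝓘(ℝ, E).tangent) (c p) :=
    hd.hasMFDerivAt.2
  rw [ModelWithCorners.range_eq_univ, hasFDerivWithinAt_univ] at h1
  have h2 : (φ ∘ Bundle.TotalSpace.proj ∘ c.symm) =ᶠ[𝓝 (c p)] Prod.fst := by
    filter_upwards [extChartAt_target_mem_nhds (I := 𝓘(ℝ, E).tangent) p] with z hz
    exact φ.right_inv (mem_extChartAt_tangent_target.1 hz)
  have h3 := (h1.congr_of_eventuallyEq h2.symm).unique hasFDerivAt_fst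
  have h4 := hΓ.second_order p
  exact (congrArg (fun L : E × E →L[ℝ] E => L (Γ p)) h3).symm.trans h4

theorem IsSODE.chartField_fst (hΓ : IsSODE Γ) {q₀ : Q} {v₀ : E} {z : E × E}
    (hz : z ∈ (extChartAt 𝓘(ℝ, E).tangent (⟨q₀, v₀⟩ : TangentBundle 𝓘(ℝ, E) Q)).target) :
    (chartField Γ (⟨q₀, v₀⟩ : TangentBundle 𝓘(ℝ, E) Q) z).1 = z.2 := by
  set p₀ : TangentBundle 𝓘(ℝ, E) Q := ⟨q₀, v₀⟩
  set c₀ := extChartAt 𝓘(ℝ, E).tangent p₀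
  set p := c₀.symm z
  set c := extChartAt 𝓘(ℝ, E).tangent p
  set φ := extChartAt 𝓘(ℝ, E) p.proj
  set φ₀ := extChartAt 𝓘(ℝ, E) q₀
  have hps : p ∈ c₀.source := c₀.map_target hz
  have hpq : p.proj ∈ φ₀.source := mem_extChartAt_tangent_source.1 hps
  have h1 : HasFDerivWithinAt (c₀ ∘ c.symm)
      (show E × E →L[ℝ] E × E from tangentCoordChange 𝓘(ℝ, E).tangent p p₀ p)
      (range 𝓘(ℝ, E).tangent) (c p) :=
    hasFDerivWithinAt_tangentCoordChange ⟨mem_extChartAt_source p, hps⟩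
  have h2 : HasFDerivWithinAt (φ₀ ∘ φ.symm) (tangentCoordChange 𝓘(ℝ, E) p.proj q₀ p.proj)
      (range 𝓘(ℝ, E)) (c p).1 :=
    hasFDerivWithinAt_tangentCoordChange ⟨mem_extChartAt_source p.proj, hpq⟩
  rw [ModelWithCorners.range_eq_univ, hasFDerivWithinAt_univ] at h1 h2
  -- both sides are the derivative of the base component of the change of charts of `TQ`
  have h3 : HasFDerivAt (Prod.fst ∘ c₀ ∘ c.symm) _ (c p) := hasFDerivAt_fst.comp (c p) h1
  have h4 : HasFDerivAt ((φ₀ ∘ φ.symm) ∘ Prod.fst) _ (c p) := h2.comp (c p) hasFDerivAt_fst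
  have h5 := h3.unique (show HasFDerivAt (Prod.fst ∘ c₀ ∘ c.symm) _ (c p) from h4)
  have h6 := congrArg (fun L : E × E →L[ℝ] E => L (Γ p)) h5
  have h7 : z.2 = tangentCoordChange 𝓘(ℝ, E) p.proj q₀ p.proj p.2 :=
    congrArg Prod.snd (c₀.right_inv hz).symm
  rw [h7]
  exact h6.trans (congrArg _ (hΓ.fst_eq p))

/-- Multiplying by a bump function extends a germ of a smooth function to the whole space. -/
theorem ContDiffOn.exists_contDiff_eventuallyEq {A B : Type*} [NormedAddCommGroup A]
    [NormedSpace ℝ A] [FiniteDimensional ℝ A] [NormedAddCommGroup B] [NormedSpace ℝ B] {f : A → B}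
    {s : Set A} {a : A} (hf : ContDiffOn ℝ ∞ f s) (hs : s ∈ 𝓝 a) :
    ∃ g : A → B, ContDiff ℝ ∞ g ∧ g =ᶠ[𝓝 a] f := by
  obtain ⟨r, hr, hrs⟩ := Metric.mem_nhds_iff.1 hs
  set χ : ContDiffBump a := ⟨r / 3, r / 2, by positivity, by linarith⟩
  refine ⟨fun x => χ x • f x, contDiff_iff_contDiffAt.2 fun x => ?_, ?_⟩
  · by_cases hx : x ∈ Metric.ball a r
    · exact χ.contDiffAt.smul (hf.contDiffAt (Filter.mem_of_superset
        (Metric.isOpen_ball.mem_nhds hx) hrs))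
    · have hx' : x ∉ tsupport χ := by
        rw [χ.tsupport_eq]
        exact fun h => hx (Metric.closedBall_subset_ball (by change r / 2 < r; linarith) h)
      refine contDiffAt_const (c := (0 : B)) |>.congr_of_eventuallyEq ?_
      filter_upwards [notMem_tsupport_iff_eventuallyEq.1 hx'] with y hy
      simp [hy]
  · filter_upwards [χ.eventuallyEq_one] with y hy
    simp [hy]

/-- In the chart at `q₀`, the exponential map at time `h` is `x₀ + h • G (h, ·)`, where `G` is smooth
up to and including `h = 0` and `G (0, ·)` is the identity. -/
theorem IsSODE.exists_expMap_eq [FiniteDimensional ℝ E] [T2Space Q] (hΓ : IsSODE Γ) (q₀ : Q) :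
    ∃ (N : Set (ℝ × E)) (G : ℝ × E → E), IsOpen N ∧ (0, 0) ∈ N ∧ ContDiffOn ℝ ∞ G N ∧
      (∀ v, ((0 : ℝ), v) ∈ N → G (0, v) = v) ∧
      ∀ h v, (h, v) ∈ N → 0 < h → v ∈ expDomain Γ h q₀ ∧
        extChartAt 𝓘(ℝ, E) q₀ q₀ + h • G (h, v) ∈ (extChartAt 𝓘(ℝ, E) q₀).target ∧
        expMap Γ h q₀ v =
          (extChartAt 𝓘(ℝ, E) q₀).symm (extChartAt 𝓘(ℝ, E) q₀ q₀ + h • G (h, v)) := by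
  have : T2Space (TangentBundle 𝓘(ℝ, E) Q) := FiberBundle.t2Space_totalSpace (F := E)
  have : CompleteSpace E := FiniteDimensional.complete ℝ E
  set p₀ : TangentBundle 𝓘(ℝ, E) Q := ⟨q₀, 0⟩
  set c₀ := extChartAt 𝓘(ℝ, E).tangent p₀
  set φ₀ := extChartAt 𝓘(ℝ, E) q₀
  have hc₀ : c₀.target ∈ 𝓝 (φ₀ q₀, (0 : E)) := by
    rw [← extChartAt_tangent_apply_base q₀ 0 0]
    exact extChartAt_target_mem_nhds p₀
  have hsm : ContDiffOn ℝ ∞ (fun z => (chartField Γ p₀ z).2) c₀.target :=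
    (contDiffOn_chartField hΓ.smooth p₀).snd
  obtain ⟨f, hf, hff⟩ := hsm.exists_contDiff_eventuallyEq hc₀
  obtain ⟨N, G, hN, h0N, hG, hG0, hsol⟩ :=
    exists_scaled_solution hf (φ₀ q₀) (Filter.inter_mem hff hc₀)
  refine ⟨N, G, hN, h0N, hG, hG0, fun h v hhv hh => ?_⟩
  obtain ⟨x, w, hx0, hw0, hxh, hxw⟩ := hsol h v hhv hh
  have hcurve : IsMIntegralCurveOn (c₀.symm ∘ fun t => (x t, w t)) Γ (Ioo (-h) (2 * h)) := by
    intro t ht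
    obtain ⟨h1, h2, h3, h4⟩ := hxw t ht
    refine (hasMFDerivAt_extChartAt_symm_comp ((h1.prodMk h2).congr_deriv ?_)
      h4).hasMFDerivWithinAt
    exact Prod.ext (hΓ.chartField_fst h4).symm h3
  have h0J : (0 : ℝ) ∈ Ioo (-h) (2 * h) := ⟨by linarith, by linarith⟩
  have hhJ : h ∈ Ioo (-h) (2 * h) := ⟨by linarith, by linarith⟩
  have hinit : (c₀.symm ∘ fun t => (x t, w t)) 0 = ⟨q₀, v⟩ := by
    simp only [Function.comp_apply, hx0, hw0]
    rw [← extChartAt_tangent_apply_base q₀ 0 v]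
    exact c₀.left_inv (mem_extChartAt_tangent_source.2 (mem_extChartAt_source q₀))
  refine ⟨fun t ht => ⟨_, _, isOpen_Ioo, ordConnected_Ioo, h0J, ⟨by linarith [ht.1],
    by linarith [ht.2]⟩, hinit, hcurve⟩, ?_, ?_⟩
  · rw [← hxh]
    exact mem_extChartAt_tangent_target.1 (hxw h hhJ).2.2.2
  · have hflow := vectorFieldFlow_eq (hΓ.smooth.of_le (by simp)) isOpen_Ioo ordConnected_Ioo h0J hhJ
      hcurve
    rw [hinit] at hflow
    rw [expMap, hflow, ← hxh]
    rfl

/-- The domain of the exponential map is the preimage of the domain of the time-`h` flow. -/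
theorem IsSODE.isOpen_expDomain [FiniteDimensional ℝ E] [T2Space Q] (hΓ : IsSODE Γ) {h : ℝ}
    (hh : 0 ≤ h) (q₀ : Q) : IsOpen (expDomain Γ h q₀) := by
  have : T2Space (TangentBundle 𝓘(ℝ, E) Q) := FiberBundle.t2Space_totalSpace (F := E)
  have : CompleteSpace E := FiniteDimensional.complete ℝ E
  have hopen := isOpen_setOf_flowDefinedAt (hΓ.smooth.of_le (n := ∞) (m := 1) (by simp))
    (fun x₀ => (contDiffOn_chartField hΓ.smooth x₀).of_le (by simp)) h
  have hcont : Continuous fun v : E => (⟨q₀, v⟩ : TangentBundle 𝓘(ℝ, E) Q) :=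
    FiberBundle.continuous_totalSpaceMk E (TangentSpace 𝓘(ℝ, E)) q₀
  convert hopen.preimage hcont using 1
  ext v
  refine ⟨fun hv => hv h ⟨hh, le_rfl⟩, ?_⟩
  rintro ⟨γ, J, hJ, hJc, h0, hhJ, hγ0, hγ⟩ t ht
  exact ⟨γ, J, hJ, hJc, h0, hJc.out h0 hhJ ht, hγ0, hγ⟩

end SODE

/-! ### The local diffeomorphism -/

theorem injective_mfderiv_of_leftInvOn {E : Type*} [NormedAddCommGroup E] [NormedSpace ℝ E]
    {Q : Type*} [TopologicalSpace Q] [ChartedSpace E Q] {f : E → Q} {g : Q → E} {V : Set E}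
    {v : E} (hV : V ∈ 𝓝 v) (hgf : LeftInvOn g f V)
    (hf : MDifferentiableAt 𝓘(ℝ, E) 𝓘(ℝ, E) f v)
    (hg : MDifferentiableAt 𝓘(ℝ, E) 𝓘(ℝ, E) g (f v)) :
    Function.Injective (mfderiv 𝓘(ℝ, E) 𝓘(ℝ, E) f v) := by
  have h1 := hg.hasMFDerivAt.comp v hf.hasMFDerivAt
  have h2 : g ∘ f =ᶠ[𝓝 v] id := Filter.mem_of_superset hV hgf
  have h3 := hasMFDerivAt_unique (h1.congr_of_eventuallyEq h2.symm) (hasMFDerivAt_id v)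
  intro x y hxy
  have hx : mfderiv 𝓘(ℝ, E) 𝓘(ℝ, E) g (f v) (mfderiv 𝓘(ℝ, E) 𝓘(ℝ, E) f v x) = x :=
    DFunLike.congr_fun h3 x
  have hy : mfderiv 𝓘(ℝ, E) 𝓘(ℝ, E) g (f v) (mfderiv 𝓘(ℝ, E) 𝓘(ℝ, E) f v y) = y :=
    DFunLike.congr_fun h3 y
  rw [← hx, ← hy, hxy]

theorem theorem3p1 {E : Type*} [NormedAddCommGroup E] [NormedSpace ℝ E] [FiniteDimensional ℝ E]
    {Q : Type*} [TopologicalSpace Q] [T2Space Q] [ChartedSpace E Q] [IsManifold 𝓘(ℝ, E) ∞ Q]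
    (Γ : (p : TangentBundle 𝓘(ℝ, E) Q) → TangentSpace 𝓘(ℝ, E).tangent p) (hΓ : IsSODE Γ)
    (q₀ : Q) :
    ∃ h₀ > (0 : ℝ), ∃ C : ℝ, ∀ h : ℝ, 0 < h → h < h₀ →
      IsOpen (expDomain Γ h q₀) ∧
      ∃ (V : Set E) (U : Set Q),
        V ⊆ expDomain Γ h q₀ ∧ q₀ ∈ U ∧
        IsDiffeoOn (expMap Γ h q₀) V U ∧
        (∀ v ∈ V, Function.Bijective (tangentExpMap Γ h q₀ v)) ∧
        ∃ v ∈ V, expMap Γ h q₀ v = q₀ ∧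
          ∀ w : E, ‖tangentExpMap Γ h q₀ v w - h • w‖ ≤ C * h ^ 2 * ‖w‖ := by
  have : CompleteSpace E := FiniteDimensional.complete ℝ E
  obtain ⟨N, G, hN, h0N, hG, hG0, hexp⟩ := hΓ.exists_expMap_eq q₀
  set φ := extChartAt 𝓘(ℝ, E) q₀
  have hGd : ∀ p ∈ N, HasFDerivAt G (fderiv ℝ G p) p := fun p hp =>
    ((hG.contDiffAt (hN.mem_nhds hp)).differentiableAt (by simp)).hasFDerivAt
  have hGslice : ∀ p ∈ N, HasFDerivAt (fun v => G (p.1, v))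
      (fderiv ℝ G p ∘L ContinuousLinearMap.inr ℝ ℝ E) p.2 := fun p hp =>
    (hGd p hp).comp p.2 (hasFDerivAt_prodMk_right p.1 p.2)
  have hD0 : ∀ v, ((0 : ℝ), v) ∈ N →
      fderiv ℝ G (0, v) ∘L ContinuousLinearMap.inr ℝ ℝ E = ContinuousLinearMap.id ℝ E := by
    intro v hv
    have hev : (fun v => G ((0 : ℝ), v)) =ᶠ[𝓝 v] id := by
      filter_upwards [(Continuous.prodMk_right (0 : ℝ)).continuousAt.preimage_mem_nhds
        (hN.mem_nhds hv)] with v' hv' using hG0 v' hv'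
    exact ((hGslice _ hv).congr_of_eventuallyEq hev.symm).unique (hasFDerivAt_id v)
  -- a ball on which the derivative of `G` is Lipschitz
  obtain ⟨K, s, hs, hK⟩ := ((hG.contDiffAt (hN.mem_nhds h0N)).fderiv_right (m := ∞)
    (by simp)).of_le (by simp) |>.exists_lipschitzOnWith
  obtain ⟨δ, hδ, hδs⟩ := Metric.mem_nhds_iff.1 (Filter.inter_mem (hN.mem_nhds h0N) hs)
  -- `(h, v) ↦ (h, G (h, v))` is a local diffeomorphism at the origin
  set b := fderiv ℝ G (0, 0) (1, 0)
  set S : ℝ × E →L[ℝ] E := (ContinuousLinearMap.fst ℝ ℝ E).smulRight b with hS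
  set T : (ℝ × E) ≃L[ℝ] ℝ × E := ContinuousLinearEquiv.equivOfInverse
    ((ContinuousLinearMap.fst ℝ ℝ E).prod (ContinuousLinearMap.snd ℝ ℝ E + S))
    ((ContinuousLinearMap.fst ℝ ℝ E).prod (ContinuousLinearMap.snd ℝ ℝ E - S))
    (fun p => by simp [S]) (fun p => by simp [S]) with hT
  have hTd : HasFDerivAt (fun p : ℝ × E => (p.1, G p)) (T : ℝ × E →L[ℝ] ℝ × E) (0, 0) := by
    refine (hasFDerivAt_fst.prodMk (hGd _ h0N)).congr_fderiv ?_
    refine ContinuousLinearMap.ext fun p => Prod.ext rfl ?_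
    have h1 : fderiv ℝ G (0, 0) (0, p.2) = p.2 := DFunLike.congr_fun (hD0 0 h0N) p.2
    have h2 : p = p.1 • ((1 : ℝ), (0 : E)) + (0, p.2) := by ext <;> simp
    change fderiv ℝ G (0, 0) p = p.2 + p.1 • b
    conv_lhs => rw [h2, map_add, map_smul, h1]
    exact add_comm _ _
  obtain ⟨e, he0, heδ, heT, hes⟩ := ((contDiff_fst.contDiffOn.prodMk hG).mono
    (hδs.trans inter_subset_left)).exists_openPartialHomeomorph Metric.isOpen_ball
      (Metric.mem_ball_self hδ) hTd
  have heN : ∀ p ∈ e.source, p ∈ N := fun p hp => (hδs (heδ hp)).1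
  have he_apply : ∀ p, e p = (p.1, G p) := fun p => congrFun heT p
  have h0t : ((0 : ℝ), (0 : E)) ∈ e.target := by
    have := e.map_source he0
    rwa [he_apply, hG0 0 h0N] at this
  obtain ⟨h₀, hh₀, hball⟩ := Metric.mem_nhds_iff.1
    ((Continuous.prodMk_left (0 : E)).continuousAt.preimage_mem_nhds (e.open_target.mem_nhds h0t))
  -- the Lipschitz constant of the derivative of `G` bounds the deviation from `h • id`
  refine ⟨h₀, hh₀, K, fun h hpos hlt => ⟨hΓ.isOpen_expDomain hpos.le q₀, ?_⟩⟩
  have hht : (h, (0 : E)) ∈ e.target :=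
    hball (by rwa [Metric.mem_ball, Real.dist_eq, sub_zero, abs_of_pos hpos])
  set V : Set E := (fun v => (h, v)) ⁻¹' e.source
  have hV : IsOpen V := e.open_source.preimage (Continuous.prodMk_right h)
  -- the inverse chart: rescale the coordinates of `q` by `h⁻¹`
  set ψ : Q → ℝ × E := fun q => (h, h⁻¹ • (φ q - φ q₀)) with hψ
  have hψs : ContMDiffOn 𝓘(ℝ, E) 𝓘(ℝ, ℝ × E) ∞ ψ φ.source :=
    (ContDiff.contMDiff (f := fun x : E => (h, h⁻¹ • (x - φ q₀))) (by fun_prop)).comp_contMDiffOn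
      (by rw [extChartAt_source]; exact contMDiffOn_extChartAt)
  set U : Set Q := φ.source ∩ ψ ⁻¹' e.target
  have hU : IsOpen U :=
    hψs.continuousOn.isOpen_inter_preimage (isOpen_extChartAt_source q₀) e.open_target
  set g : Q → E := fun q => (e.symm (ψ q)).2
  have hexpV : ∀ v ∈ V, v ∈ expDomain Γ h q₀ ∧ φ q₀ + h • G (h, v) ∈ φ.target ∧
      expMap Γ h q₀ v = φ.symm (φ q₀ + h • G (h, v)) := fun v hv => hexp h v (heN _ hv) hpos
  have hφexp : ∀ v ∈ V, φ (expMap Γ h q₀ v) = φ q₀ + h • G (h, v) := fun v hv => by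
    rw [(hexpV v hv).2.2, φ.right_inv (hexpV v hv).2.1]
  have hψexp : ∀ v ∈ V, ψ (expMap Γ h q₀ v) = e (h, v) := fun v hv => by
    rw [hψ, he_apply]
    simp only [hφexp v hv, add_sub_cancel_left, smul_smul, inv_mul_cancel₀ hpos.ne', one_smul]
  have hmaps : MapsTo (expMap Γ h q₀) V U := fun v hv => by
    refine ⟨?_, ?_⟩
    · rw [(hexpV v hv).2.2]
      exact φ.map_target (hexpV v hv).2.1
    · rw [mem_preimage, hψexp v hv]
      exact e.map_source hv
  have hleft : LeftInvOn g (expMap Γ h q₀) V := fun v hv => by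
    change (e.symm (ψ _)).2 = v
    rw [hψexp v hv, e.left_inv hv]
  have hsurj : SurjOn (expMap Γ h q₀) V U := by
    rintro q ⟨hq, hqt⟩
    have hp := e.right_inv hqt
    rw [he_apply] at hp
    have hp1 : (e.symm (ψ q)).1 = h := congrArg Prod.fst hp
    have hp2 : G (e.symm (ψ q)) = h⁻¹ • (φ q - φ q₀) := congrArg Prod.snd hp
    have hpe : (h, (e.symm (ψ q)).2) = e.symm (ψ q) := Prod.ext hp1.symm rfl
    have hv : (e.symm (ψ q)).2 ∈ V := by
      change (h, (e.symm (ψ q)).2) ∈ e.source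
      rw [hpe]
      exact e.map_target hqt
    refine ⟨_, hv, ?_⟩
    rw [(hexpV _ hv).2.2, hpe, hp2, smul_smul, mul_inv_cancel₀ hpos.ne', one_smul,
      add_sub_cancel, φ.left_inv hq]
  have hq₀U : q₀ ∈ U := ⟨mem_extChartAt_source q₀, by simpa [hψ] using hht⟩
  have hGV : ContDiffOn ℝ ∞ (fun v => φ q₀ + h • G (h, v)) V :=
    contDiffOn_const.add (contDiffOn_const.smul
      (hG.comp (contDiff_prodMk_right h).contDiffOn fun v hv => heN _ hv))
  have hsmooth : ContMDiffOn 𝓘(ℝ, E) 𝓘(ℝ, E) ∞ (expMap Γ h q₀) V :=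
    ((contMDiffOn_extChartAt_symm q₀).comp hGV.contMDiffOn fun v hv => (hexpV v hv).2.1).congr
      fun v hv => (hexpV v hv).2.2
  have hgs : ContMDiffOn 𝓘(ℝ, E) 𝓘(ℝ, E) ∞ g U :=
    (ContDiffOn.contMDiffOn hes.snd).comp (hψs.mono inter_subset_left) fun q hq => hq.2
  have hexpd : ∀ v ∈ V, MDifferentiableAt 𝓘(ℝ, E) 𝓘(ℝ, E) (expMap Γ h q₀) v := fun v hv =>
    (hsmooth.contMDiffAt (hV.mem_nhds hv)).mdifferentiableAt (by simp)
  refine ⟨V, U, fun v hv => (hexpV v hv).1, hq₀U,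
    ⟨hV, hU, ⟨hmaps, hleft.injOn, hsurj⟩, hsmooth, g, hleft, hgs⟩, fun v hv => ?_, ?_⟩
  · have hinj : Function.Injective (tangentExpMap Γ h q₀ v) :=
      injective_mfderiv_of_leftInvOn (hV.mem_nhds hv) hleft (hexpd v hv)
        ((hgs.contMDiffAt (hU.mem_nhds (hmaps hv))).mdifferentiableAt (by simp))
    exact ⟨hinj, LinearMap.injective_iff_surjective.1 hinj⟩
  · obtain ⟨v, hv, hvq⟩ := hsurj hq₀U
    refine ⟨v, hv, hvq, fun w => ?_⟩
    have h1 : HasFDerivWithinAt (extChartAt 𝓘(ℝ, E) (expMap Γ h q₀ v) ∘ expMap Γ h q₀)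
        (tangentExpMap Γ h q₀ v) (range 𝓘(ℝ, E)) v := (hexpd v hv).hasMFDerivAt.2
    rw [hvq, ModelWithCorners.range_eq_univ, hasFDerivWithinAt_univ] at h1
    have h2 : (φ ∘ expMap Γ h q₀) =ᶠ[𝓝 v] fun v => φ q₀ + h • G (h, v) :=
      Filter.mem_of_superset (hV.mem_nhds hv) hφexp
    have h3 := h1.unique ((((hGslice _ (heN _ hv)).const_smul h).const_add (φ q₀)
      ).congr_of_eventuallyEq h2)
    have hvδ : (h, v) ∈ Metric.ball ((0 : ℝ), (0 : E)) δ := heδ hv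
    have h0vδ : ((0 : ℝ), v) ∈ Metric.ball ((0 : ℝ), (0 : E)) δ := by
      simp only [Metric.mem_ball, Prod.dist_eq, max_lt_iff] at hvδ ⊢
      exact ⟨by simpa using hδ, hvδ.2⟩
    have h4 : w = fderiv ℝ G (0, v) (0, w) :=
      (DFunLike.congr_fun (hD0 v (hδs h0vδ).1) w).symm
    have h5 := hK.norm_sub_le (hδs hvδ).2 (hδs h0vδ).2
    have h6 : ‖((h, v) : ℝ × E) - (0, v)‖ = h := by simp [Prod.norm_def, abs_of_pos hpos, hpos.le]
    rw [h6] at h5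
    have h7 : tangentExpMap Γ h q₀ v w - h • w =
        h • (fderiv ℝ G (h, v) - fderiv ℝ G (0, v)) (0, w) := by
      rw [h3, sub_apply, ← h4, smul_sub]
      rfl
    rw [h7, norm_smul, Real.norm_of_nonneg hpos.le]
    calc h * ‖(fderiv ℝ G (h, v) - fderiv ℝ G (0, v)) (0, w)‖
        ≤ h * (K * h * ‖((0 : ℝ), w)‖) := by
          gcongr
          exact ContinuousLinearMap.le_of_opNorm_le _ h5 _
      _ = K * h ^ 2 * ‖w‖ := by simp [Prod.norm_def]; ring
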